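/- Let $\mathbf N$ be the space of locally finite (not necessarily simple) counting measures on $\mathbb R^d$, i.e. Borel measures taking values in $\mathbb N$ on bounded Borel sets, with the vague topology and its Borel $\sigma$-field. Write $x\in\phi$ if $\phi(\{x\})>0$, and let $\mathbf N^0=\{\phi\in\mathbf N:0\in\phi\}$ and $(\theta_t\phi)(B)=\phi(B+t)$. A point-map $g$ is a measurable map selecting a point $g(\phi)\in\phi$ for each simple $\phi\in\mathbf N^0$, extended to $\mathbf N^0$ through the support (that is, by forgetting multiplicities). Its point-shift is $f_g(\phi,x)=g(\theta_x\phi)+x$ for $x\in\phi$; write $f_\phi(x)=f_g(\phi,x)$ and $g^n(\phi)=f_\phi^n(0)$ for $\phi\in\mathbf N^0$, $n\ge0$. Let $(\Phi,\mathbb P)$ be a stationary point process: $\mathbb P$ is a probability measure on a measurable space $\Omega$, invariant under a measurable flow $(\theta_t)_{t\in\mathbb R^d}$ on $\Omega$, and $\Phi:\Omega\to\mathbf N$ is measurable with $\Phi(\theta_t\omega)=\theta_t\Phi(\omega)$ for all $t,\omega$. Suppose that its intensity $\lambda=\mathbb E[\Phi([0,1)^d)]$ satisfies $0<\lambda<\infty$.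 Let $\mathcal P_0$ be its Palm distribution, i.e. the law of $\Phi$, as a measure on $\mathbf N^0$, under $$\mathbb P_\Phi[F]=\frac1{\lambda|B|}\int_\Omega\int_B \mathbf 1\{\theta_t\omega\in F\}\,\Phi(\omega)(dt)\,\mathbb P(d\omega),$$ where $B$ is any Borel set with $0<|B|<\infty$, and let $\mathcal P_0^{g,n}$ be the image of $\mathcal P_0$ under $\phi\mapsto\theta_{g^n(\phi)}\phi$, so that $\mathcal P_0^{g,0}=\mathcal P_0$. Suppose that $f_g$ has finite orbits on $(\Phi,\mathbb P)$: for $\Phi_*\mathbb P$-almost every $\phi$ and every $x\in\phi$, the set $\{f_\phi^n(x):n\ge 0\}$ is finite. Then each $\mathcal P_0^{g,n}$ is a probability measure on $\mathbf N^0$, and the orbit $\{\mathcal P_0^{g,n}:n\ge 0\}$ is relatively compact (has compact closure) in the space of probability measures on $\mathbf N^0$ with the topology of weak convergence. In particular, $g$ probabilities of $\mathcal P_0$ exist: there are $n_1<n_2<\cdots$ such that $\mathcal P_0^{g,n_i}$ converges weakly to a probability measure on $\mathbf N^0$. -/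

import Mathlib

open MeasureTheory Filter Topology
open scoped NNReal ENNReal CompactlySupported

noncomputable section

namespace PointMapPalm

/-- The state space `ℝ^d`. -/
abbrev E (d : ℕ) : Type := EuclideanSpace ℝ (Fin d)

/-- The space `N` of locally finite counting measures on `ℝ^d` (not necessarily simple): Borel
measures whose value on every bounded Borel set is a natural number. -/
@[ext]
structure CountingMeasure (d : ℕ) where
  /-- the underlying Borel measure -/
  toMeasure : Measure (E d)
  nat_valued : ∀ B : Set (E d), MeasurableSet B → Bornology.IsBounded B →
    ∃ k : ℕ, toMeasure B = k

/-- The vague topology: the coarsest one making `φ ↦ ∫ h dφ` continuous for every nonnegative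
continuous `h` with compact support. -/
instance (d : ℕ) : TopologicalSpace (CountingMeasure d) :=
  TopologicalSpace.induced
    (fun (φ : CountingMeasure d) (h : C_c(E d, ℝ≥0)) => ∫ x, (h x : ℝ) ∂φ.toMeasure)
    inferInstance

/-- The Borel σ-field of the vague topology. -/
instance (d : ℕ) : MeasurableSpace (CountingMeasure d) := borel _

instance (d : ℕ) : BorelSpace (CountingMeasure d) := ⟨rfl⟩

namespace CountingMeasure

variable {d : ℕ}

/-- The set of points (atoms) of a counting measure; `x ∈ φ` means `x ∈ φ.points`. -/
def points (φ : CountingMeasure d) : Set (E d) := {x | φ.toMeasure {x} ≠ 0}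

/-- The translate `θ_t φ`, that is `(θ_t φ)(B) = φ(B + t)`: every point `x` of `φ` is moved
to `x - t`. -/
def shift (t : E d) (φ : CountingMeasure d) : CountingMeasure d where
  toMeasure := φ.toMeasure.map (fun x => x - t)
  nat_valued B hB hbd := by
    have hm : Measurable (fun x : E d => x - t) := measurable_id.sub_const t
    rw [Measure.map_apply hm hB]
    refine φ.nat_valued _ (hm hB) ?_
    have h : (fun x : E d => x - t) ⁻¹' B = (fun x => x + t) '' B := by
      ext x
      constructor
      · intro hx
        exact ⟨x - t, hx, by simp⟩
      · rintro ⟨y, hy, rfl⟩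
        simpa using hy
    rw [h]
    exact ((LipschitzWith.id.add (LipschitzWith.const t)).isBounded_image hbd)

theorem mem_points_shift {t x : E d} {φ : CountingMeasure d} :
    x ∈ (φ.shift t).points ↔ x + t ∈ φ.points := by
  have hm : Measurable (fun x : E d => x - t) := measurable_id.sub_const t
  have h : (fun y : E d => y - t) ⁻¹' {x} = {x + t} := by
    ext y
    simp [sub_eq_iff_eq_add]
  change φ.toMeasure.map (fun x => x - t) {x} ≠ 0 ↔ φ.toMeasure {x + t} ≠ 0
  rw [Measure.map_apply hm (measurableSet_singleton x), h]

theorem one_le_of_mem {φ : CountingMeasure d} {x : E d} (hx : x ∈ φ.points) :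
    1 ≤ φ.toMeasure {x} := by
  obtain ⟨k, hk⟩ := φ.nat_valued {x} (measurableSet_singleton x) Bornology.isBounded_singleton
  have hx' : φ.toMeasure {x} ≠ 0 := hx
  rw [hk] at hx' ⊢
  have : k ≠ 0 := by rintro rfl; simp at hx'
  exact_mod_cast Nat.one_le_iff_ne_zero.mpr this

theorem finite_inter_points (φ : CountingMeasure d) {B : Set (E d)} (hB : MeasurableSet B)
    (hbd : Bornology.IsBounded B) : (B ∩ φ.points).Finite := by
  obtain ⟨k, hk⟩ := φ.nat_valued B hB hbd
  by_contra hinf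
  obtain ⟨s, hs, hcard⟩ := (show (B ∩ φ.points).Infinite from hinf).exists_subset_card_eq (k + 1)
  have h1 : ((k + 1 : ℕ) : ℝ≥0∞) ≤ φ.toMeasure (s : Set (E d)) := by
    rw [← sum_measure_singleton, ← hcard]
    calc ((s.card : ℕ) : ℝ≥0∞) = ∑ _x ∈ s, (1 : ℝ≥0∞) := by simp
      _ ≤ _ := Finset.sum_le_sum fun x hx => one_le_of_mem (hs hx).2
  have h2 : φ.toMeasure (s : Set (E d)) ≤ k := by
    rw [← hk]
    exact measure_mono fun x hx => (hs hx).1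
  have h3 := h1.trans h2
  norm_cast at h3
  omega

/-- The support of a counting measure as a simple counting measure: the same points, each
with multiplicity one. -/
def supp (φ : CountingMeasure d) : CountingMeasure d where
  toMeasure := Measure.count.restrict φ.points
  nat_valued B hB hbd := by
    have hfin := φ.finite_inter_points hB hbd
    rw [Measure.restrict_apply hB, Measure.count_apply_finite _ hfin]
    exact ⟨_, rfl⟩

theorem supp_singleton_of_mem {φ : CountingMeasure d} {x : E d} (hx : x ∈ φ.points) :
    φ.supp.toMeasure {x} = 1 := by
  have h : ({x} : Set (E d)) ∩ φ.points = {x} := by simpa using hx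
  simp only [supp]
  rw [Measure.restrict_apply (measurableSet_singleton x), h, Measure.count_singleton]

theorem supp_singleton_of_notMem {φ : CountingMeasure d} {x : E d} (hx : x ∉ φ.points) :
    φ.supp.toMeasure {x} = 0 := by
  have h : ({x} : Set (E d)) ∩ φ.points = ∅ := by simpa using hx
  simp only [supp]
  rw [Measure.restrict_apply (measurableSet_singleton x), h, measure_empty]

theorem points_supp (φ : CountingMeasure d) : φ.supp.points = φ.points := by
  ext x
  by_cases hx : x ∈ φ.points
  · simp [points, supp_singleton_of_mem hx, show φ.toMeasure {x} ≠ 0 from hx]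
  · have h0 : φ.toMeasure {x} = 0 := by simpa [points] using hx
    simp [points, supp_singleton_of_notMem hx, h0]

/-- Simple counting measures: all multiplicities are at most one. -/
def IsSimple (φ : CountingMeasure d) : Prop := ∀ x, φ.toMeasure {x} ≤ 1

theorem isSimple_supp (φ : CountingMeasure d) : φ.supp.IsSimple := by
  intro x
  by_cases hx : x ∈ φ.points
  · exact (supp_singleton_of_mem hx).le
  · exact (supp_singleton_of_notMem hx).le.trans zero_le_one

end CountingMeasure

/-- `N⁰`: the counting measures that have a point at the origin, with the vague topology and its
Borel σ-field. -/
abbrev CountingMeasure₀ (d : ℕ) : Type := {φ : CountingMeasure d // (0 : E d) ∈ φ.points}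

/-- The simple counting measures that have a point at the origin. -/
abbrev SimpleCountingMeasure₀ (d : ℕ) : Type :=
  {φ : CountingMeasure d // φ.IsSimple ∧ (0 : E d) ∈ φ.points}

/-- A (simple) point-map: a measurable map which selects a point of each simple counting measure
that has a point at the origin. -/
structure PointMap (d : ℕ) where
  /-- the selected point -/
  toFun : SimpleCountingMeasure₀ d → E d
  measurable_toFun : Measurable toFun
  mem_points : ∀ φ, toFun φ ∈ φ.1.points

namespace PointMap

variable {d : ℕ} (g : PointMap d)

/-- The extension of a point-map to all of `N⁰`, through the support. -/
def ext (φ : CountingMeasure₀ d) : E d :=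
  g.toFun ⟨φ.1.supp, φ.1.isSimple_supp, by rw [φ.1.points_supp]; exact φ.2⟩

theorem ext_mem (φ : CountingMeasure₀ d) : g.ext φ ∈ φ.1.points := by
  have h := g.mem_points ⟨φ.1.supp, φ.1.isSimple_supp, by rw [φ.1.points_supp]; exact φ.2⟩
  exact φ.1.points_supp ▸ h

end PointMap

/-- `θ_x φ ∈ N⁰` for a point `x` of `φ`. -/
def shiftAt {d : ℕ} (φ : CountingMeasure d) (x : φ.points) : CountingMeasure₀ d :=
  ⟨φ.shift x, CountingMeasure.mem_points_shift.mpr (by simp)⟩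

namespace PointMap

variable {d : ℕ} (g : PointMap d)

/-- The compatible point-shift `f_g(φ, x) = g(θ_x φ) + x` of a point-map, as a self-map
of the set of points of `φ`. -/
def pointShift (φ : CountingMeasure d) (x : φ.points) : φ.points :=
  ⟨g.ext (shiftAt φ x) + x, CountingMeasure.mem_points_shift.mp (g.ext_mem (shiftAt φ x))⟩

/-- The point-map `g^n` of the `n`-th iterate of the point-shift: `g^n(φ) = f_g^n(φ, 0)`. -/
def iter (n : ℕ) (φ : CountingMeasure₀ d) : φ.1.points := (g.pointShift φ.1)^[n] ⟨0, φ.2⟩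

/-- The map `φ ↦ θ_{g^n(φ)} φ` from `N⁰` to itself. -/
def theta (n : ℕ) (φ : CountingMeasure₀ d) : CountingMeasure₀ d := shiftAt φ.1 (g.iter n φ)

end PointMap

/-- A measurable flow `(θ_t)`, `t ∈ ℝ^d`, on `Ω`. -/
structure IsMeasurableFlow {d : ℕ} {Ω : Type*} [MeasurableSpace Ω] (θ : E d → Ω → Ω) : Prop where
  measurable : Measurable (fun p : E d × Ω => θ p.1 p.2)
  zero : ∀ ω, θ 0 ω = ω
  add : ∀ s t ω, θ (s + t) ω = θ s (θ t ω)

/-- `(Φ, ℙ)` is a stationary point process on `ℝ^d`: `Φ` is measurable and compatible with the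
measurable flow `θ`, and the probability measure `ℙ` is invariant under `θ`. -/
structure IsStationaryPointProcess {d : ℕ} {Ω : Type*} [MeasurableSpace Ω] (θ : E d → Ω → Ω)
    (ℙ : Measure Ω) (Φ : Ω → CountingMeasure d) : Prop where
  flow : IsMeasurableFlow θ
  isProbabilityMeasure : IsProbabilityMeasure ℙ
  measurable : Measurable Φ
  compatible : ∀ t ω, Φ (θ t ω) = (Φ ω).shift t
  stationary : ∀ t, ℙ.map (θ t) = ℙ

/-- The intensity `λ`: the mean number of points, with multiplicities, in the unit cube. -/
def intensity {d : ℕ} {Ω : Type*} [MeasurableSpace Ω] (ℙ : Measure Ω)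
    (Φ : Ω → CountingMeasure d) : ℝ≥0∞ :=
  ∫⁻ ω, (Φ ω).toMeasure {x : E d | ∀ i, x i ∈ Set.Ico (0 : ℝ) 1} ∂ℙ

/-- The Palm probability on `Ω`, computed with the window `B`:
`F ↦ (λ |B|)⁻¹ ∫ (∑_{t ∈ Φ(ω) ∩ B} 1{θ_t ω ∈ F}) ℙ(dω)`, the sum being over points with
multiplicities, i.e. an integral with respect to `Φ(ω)` restricted to `B`. -/
def palm {d : ℕ} {Ω : Type*} [MeasurableSpace Ω] (θ : E d → Ω → Ω) (ℙ : Measure Ω)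
    (Φ : Ω → CountingMeasure d) (B : Set (E d)) : Measure Ω :=
  (intensity ℙ Φ * volume B)⁻¹ •
    ℙ.bind (fun ω => ((Φ ω).toMeasure.restrict B).map (fun t => θ t ω))

/-- The Palm distribution `𝒫₀ = Φ_* ℙ_Φ`, as a measure on `N⁰`. -/
def palmDistribution {d : ℕ} {Ω : Type*} [MeasurableSpace Ω] (θ : E d → Ω → Ω) (ℙ : Measure Ω)
    (Φ : Ω → CountingMeasure d) (B : Set (E d)) : Measure (CountingMeasure₀ d) :=
  ((palm θ ℙ Φ B).map Φ).comap Subtype.val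

/-- The `n`-th `g`-Palm distribution `𝒫₀^{g,n} = (θ_{g^n})_* 𝒫₀` on `N⁰`. -/
def gPalm {d : ℕ} {Ω : Type*} [MeasurableSpace Ω] (θ : E d → Ω → Ω) (ℙ : Measure Ω)
    (Φ : Ω → CountingMeasure d) (B : Set (E d)) (g : PointMap d) (n : ℕ) :
    Measure (CountingMeasure₀ d) :=
  (palmDistribution θ ℙ Φ B).map (g.theta n)

/-- The point-shift of `g` has finite orbits on `(Φ, ℙ)`: for almost every realization `φ`, the
orbit of every point of `φ` is finite. -/
def HasFiniteOrbits {d : ℕ} {Ω : Type*} [MeasurableSpace Ω] (g : PointMap d) (ℙ : Measure Ω)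
    (Φ : Ω → CountingMeasure d) : Prop :=
  ∀ᵐ φ ∂(ℙ.map Φ), ∀ x : φ.points,
    (Set.range fun n : ℕ => (g.pointShift φ)^[n] x).Finite

/-- The `ω`-limit set of an orbit `(x_n)`: the limits of its subsequences. -/
def omegaLimitSet {X : Type*} [TopologicalSpace X] (x : ℕ → X) : Set X :=
  {y | ∃ n : ℕ → ℕ, StrictMono n ∧ Tendsto (fun i => x (n i)) atTop (𝓝 y)}

end PointMapPalm

end

noncomputable section

namespace PointMapPalm

/-! By Prokhorov's theorem it suffices to prove tightness of the laws $\mathcal P_0^{g,n}$,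
uniformly in $n$. Under the Palm distribution almost every configuration has a finite orbit of the
origin, so the recentred configurations $\theta_{g^n(\phi)}\phi$, $n\ge 0$, are finitely many, and
the mass they put on a given ball is bounded in $n$ (`ae_palmDistribution_exists_bound`). The event
that some $n$ violates the bound $k$ therefore has probability tending to $0$ as $k\to\infty$.
Choosing one bound $k_r$ per radius $r$ with summable errors gives a single set that serves every
$n$ (`isTightMeasureSet_gPalm`).

That set is compact in $\mathbf N^0$ (`isCompact_setOf_pairing_cutoff_le`): bounded local mass gives
limits along ultrafilters by Riesz representation, integrality survives because small balls have
eventually constant mass, and the point at the origin survives because its mass is at least one.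

The finite-orbit hypothesis concerns $\Phi_*\mathbb P$; `ae_palm_of_ae` carries it to the Palm side,
and `meanMeasure_eq` shows that the Palm measure is a probability measure. -/

/-! ### Cutoff functions -/

open Metric in
/-- The Lipschitz cutoff of a bounded set, as a compactly supported function. -/
def bump {d : ℕ} {δ : ℝ} (hδ : 0 < δ) {K : Set (E d)} (hK : Bornology.IsBounded K) :
    C_c(E d, ℝ≥0) where
  toContinuousMap := (thickenedIndicator hδ K).toContinuousMap
  hasCompactSupport' := by
    refine HasCompactSupport.of_support_subset_isCompact
      (K := closure (thickening δ K)) hK.thickening.isCompact_closure ?_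
    intro x hx
    by_contra h
    exact hx (thickenedIndicator_zero hδ K fun h' => h (subset_closure h'))

/-- The cutoff of the closed ball of radius `n` around the origin. -/
def cutoff (d n : ℕ) : C_c(E d, ℝ≥0) :=
  bump one_pos (Metric.isBounded_closedBall (x := (0 : E d)) (r := n))

section bump

variable {d : ℕ} {δ : ℝ} (hδ : 0 < δ) {K : Set (E d)} (hK : Bornology.IsBounded K)

theorem bump_le_one (x : E d) : bump hδ hK x ≤ 1 := thickenedIndicator_le_one hδ K x

theorem bump_eq_one {x : E d} (hx : x ∈ K) : bump hδ hK x = 1 := thickenedIndicator_one hδ K hx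

theorem bump_eq_zero {x : E d} (hx : x ∉ Metric.thickening δ K) : bump hδ hK x = 0 :=
  thickenedIndicator_zero hδ K hx

theorem cutoff_eq_one {n : ℕ} {x : E d} (hx : ‖x‖ ≤ n) : cutoff d n x = 1 :=
  bump_eq_one _ _ (by simpa using hx)

end bump

/-! ### The vague topology: separation, countable base, pseudometrizability -/

namespace CountingMeasure

variable {d : ℕ}

theorem measure_lt_top (φ : CountingMeasure d) {s : Set (E d)} (hs : Bornology.IsBounded s) :
    φ.toMeasure s < ∞ := by
  obtain ⟨k, hk⟩ := φ.nat_valued _ measurableSet_closure hs.closure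
  exact (measure_mono subset_closure).trans_lt (hk ▸ ENNReal.natCast_lt_top k)

instance (φ : CountingMeasure d) : IsFiniteMeasureOnCompacts φ.toMeasure :=
  ⟨fun _ hK => φ.measure_lt_top hK.isBounded⟩

theorem integrable (φ : CountingMeasure d) (h : C_c(E d, ℝ≥0)) :
    Integrable (fun x => (h x : ℝ)) φ.toMeasure :=
  Continuous.integrable_of_hasCompactSupport (by fun_prop)
    (HasCompactSupport.comp_left h.hasCompactSupport rfl)

/-- The integral of a compactly supported function against a counting measure. -/
def pairing (h : C_c(E d, ℝ≥0)) (φ : CountingMeasure d) : ℝ := ∫ x, (h x : ℝ) ∂φ.toMeasure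

theorem lintegral_eq_pairing (h : C_c(E d, ℝ≥0)) (φ : CountingMeasure d) :
    ∫⁻ x, h x ∂φ.toMeasure = ENNReal.ofReal (pairing h φ) :=
  lintegral_coe_eq_integral _ (φ.integrable h)

theorem pairing_nonneg (h : C_c(E d, ℝ≥0)) (φ : CountingMeasure d) : 0 ≤ pairing h φ :=
  integral_nonneg fun _ => NNReal.coe_nonneg _

theorem pairing_mono {h h' : C_c(E d, ℝ≥0)} (hh : ∀ x, h x ≤ h' x) (φ : CountingMeasure d) :
    pairing h φ ≤ pairing h' φ :=
  integral_mono (φ.integrable h) (φ.integrable h') fun x => NNReal.coe_le_coe.2 (hh x)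

theorem pairing_add (h h' : C_c(E d, ℝ≥0)) (φ : CountingMeasure d) :
    pairing (h + h') φ = pairing h φ + pairing h' φ := by
  simp [pairing, integral_add (φ.integrable h) (φ.integrable h')]

theorem pairing_smul (c : ℝ≥0) (h : C_c(E d, ℝ≥0)) (φ : CountingMeasure d) :
    pairing (c • h) φ = c * pairing h φ := by
  simp [pairing, integral_const_mul]

theorem topology_eq_induced_pairing :
    instTopologicalSpaceCountingMeasure d =
      TopologicalSpace.induced (fun φ h => pairing h φ) inferInstance := rfl

theorem continuous_pairing (h : C_c(E d, ℝ≥0)) : Continuous (pairing h) :=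
  (continuous_apply h).comp (continuous_induced_dom
    (f := fun (φ : CountingMeasure d) (h : C_c(E d, ℝ≥0)) => pairing h φ))

theorem measurable_pairing (h : C_c(E d, ℝ≥0)) : Measurable (pairing h) :=
  (continuous_pairing h).measurable

/-- Convergence in the vague topology, tested on each function. -/
theorem le_nhds_iff_pairing {l : Filter (CountingMeasure d)} {φ : CountingMeasure d} :
    l ≤ 𝓝 φ ↔ ∀ h, Tendsto (pairing h) l (𝓝 (pairing h φ)) := by
  rw [nhds_induced, ← tendsto_iff_comap, tendsto_pi_nhds]
  rfl

/-- This is uniqueness in the Riesz representation theorem; it makes the vague topology Hausdorff.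
-/
theorem pairing_ext {φ ψ : CountingMeasure d} (h : ∀ f, pairing f φ = pairing f ψ) : φ = ψ :=
  CountingMeasure.ext (Measure.ext_of_integral_eq_on_compactlySupported_nnreal h)

instance : T2Space (CountingMeasure d) := by
  refine T2Space.of_injective_continuous (f := fun (φ : CountingMeasure d) h => pairing h φ) ?_
    (continuous_pi continuous_pairing)
  exact fun φ ψ h => pairing_ext fun f => congrFun h f

theorem abs_pairing_sub_le {h h' χ : C_c(E d, ℝ≥0)} {ε : ℝ}
    (H : ∀ x, |(h x : ℝ) - h' x| ≤ ε * χ x) (φ : CountingMeasure d) :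
    |pairing h φ - pairing h' φ| ≤ ε * pairing χ φ := by
  unfold pairing
  rw [← integral_sub (φ.integrable h) (φ.integrable h'), ← integral_const_mul]
  exact (abs_integral_le_integral_abs).trans
    (integral_mono ((φ.integrable h).sub (φ.integrable h')).abs ((φ.integrable χ).const_mul ε) H)

/-- A countable family of compactly supported functions which approximates each function
supported in a ball, uniformly. -/
theorem exists_countable_approx (d : ℕ) : ∃ D : Set C_c(E d, ℝ≥0), D.Countable ∧
    (∀ n, cutoff d n ∈ D) ∧ ∀ h : C_c(E d, ℝ≥0), ∃ n, ∀ ε > 0, ∃ h' ∈ D,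
      ∀ x, |(h x : ℝ) - h' x| ≤ ε * cutoff d n x := by
  let X : ℕ → Type := fun n => {h : C_c(E d, ℝ≥0) // ∀ x, (n : ℝ) < ‖x‖ → h x = 0}
  let F : ∀ n, X n → C(E d, ℝ≥0) := fun n h => h.1.toContinuousMap
  have key : ∀ n, ∃ s : Set (X n), s.Countable ∧ ∀ h : X n, ∀ ε > 0, ∃ h' ∈ s,
      ∀ x, |(h.1 x : ℝ) - h'.1 x| ≤ ε * cutoff d n x := by
    intro n
    -- The compact-open topology is second countable, so this subspace is separable. Closeness in it
    -- is uniform on the ball, and outside the ball both functions vanish.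
    let : TopologicalSpace (X n) := TopologicalSpace.induced (F n) inferInstance
    have hF : Continuous (F n) := continuous_induced_dom
    have : SecondCountableTopology (X n) := TopologicalSpace.secondCountableTopology_induced _ _ _
    obtain ⟨s, hs, hd⟩ := TopologicalSpace.exists_countable_dense (X n)
    refine ⟨s, hs, fun h ε hε => ?_⟩
    have h1 := ContinuousMap.tendsto_iff_forall_isCompact_tendstoUniformlyOn.1 (hF.tendsto h)
      (Metric.closedBall 0 n) (isCompact_closedBall _ _)
    have h2 := Metric.tendstoUniformlyOn_iff.1 h1 ε hε
    obtain ⟨h', hs', hh'⟩ := hd.inter_nhds_nonempty h2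
    refine ⟨h', hs', fun x => ?_⟩
    by_cases hx : ‖x‖ ≤ n
    · rw [cutoff_eq_one hx, NNReal.coe_one, mul_one]
      have H : |(h.1 x : ℝ) - h'.1 x| < ε := hh' x (by simpa using hx)
      exact H.le
    · push Not at hx
      rw [h.2 x hx, h'.2 x hx]
      simp only [NNReal.coe_zero, sub_zero, abs_zero]
      positivity
  choose s hs hs' using key
  refine ⟨(⋃ n, Subtype.val '' s n) ∪ Set.range (cutoff d),
    (Set.countable_iUnion fun n => (hs n).image _).union (Set.countable_range _),
    fun n => Or.inr ⟨n, rfl⟩, fun h => ?_⟩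
  obtain ⟨r, hr⟩ := h.hasCompactSupport.isBounded.exists_norm_le
  obtain ⟨n, hn⟩ := exists_nat_ge r
  refine ⟨n, fun ε hε => ?_⟩
  obtain ⟨h', hh', H⟩ := hs' n ⟨h, fun x hx => by
    by_contra h0
    exact absurd (hr x (subset_tsupport _ h0)) (not_le.2 (hn.trans_lt hx))⟩ ε hε
  exact ⟨h'.1, Or.inl (Set.mem_iUnion.2 ⟨n, h', hh', rfl⟩), H⟩

/-- The vague topology is induced by countably many functions. -/
theorem exists_countable_isInducing (d : ℕ) : ∃ D : Set C_c(E d, ℝ≥0), D.Countable ∧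
    IsInducing fun (φ : CountingMeasure d) (h : D) => pairing h.1 φ := by
  obtain ⟨D, hD, hcut, happ⟩ := exists_countable_approx d
  refine ⟨D, hD, ⟨le_antisymm ?_ ?_⟩⟩
  · rw [← continuous_iff_le_induced]
    exact continuous_pi fun h => continuous_pairing h.1
  · rw [topology_eq_induced_pairing, ← continuous_iff_le_induced]
    let τ : TopologicalSpace (CountingMeasure d) :=
      TopologicalSpace.induced (fun φ (h : D) => pairing h.1 φ) inferInstance
    have hc : ∀ h ∈ D, Continuous[τ, _] (pairing h) := fun h hh =>
      (continuous_apply (⟨h, hh⟩ : D)).comp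
        (continuous_induced_dom (f := fun φ (h : D) => pairing h.1 φ))
    refine continuous_pi fun h => ?_
    obtain ⟨n, hn⟩ := happ h
    refine continuous_of_locally_uniform_approx_of_continuousAt fun φ u hu => ?_
    obtain ⟨ε, hε, hεu⟩ := Metric.mem_uniformity_dist.1 hu
    -- Near `φ` the cutoff mass stays below this number, so dividing `ε` by it keeps the
    -- approximation error below `ε` throughout that neighbourhood.
    have h0 : 0 < pairing (cutoff d n) φ + 1 := by linarith [pairing_nonneg (cutoff d n) φ]
    obtain ⟨h', hh', H⟩ := hn (ε / (pairing (cutoff d n) φ + 1)) (by positivity)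
    refine ⟨_, ((hc _ (hcut n)).tendsto φ).eventually (gt_mem_nhds (lt_add_one _)), pairing h',
      (hc h' hh').continuousAt, fun ψ hψ => hεu ?_⟩
    rw [Real.dist_eq]
    refine (abs_pairing_sub_le H ψ).trans_lt ?_
    have hψ' : pairing (cutoff d n) ψ < pairing (cutoff d n) φ + 1 := hψ
    calc _ < ε / (pairing (cutoff d n) φ + 1) * (pairing (cutoff d n) φ + 1) := by gcongr
      _ = ε := by field_simp

instance : SecondCountableTopology (CountingMeasure d) := by
  obtain ⟨D, hD, hI⟩ := exists_countable_isInducing d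
  have := hD.to_subtype
  exact hI.secondCountableTopology

instance : TopologicalSpace.PseudoMetrizableSpace (CountingMeasure d) := by
  obtain ⟨D, hD, hI⟩ := exists_countable_isInducing d
  have := hD.to_subtype
  exact hI.pseudoMetrizableSpace

/-- Measurability of a random counting measure, tested on each function. -/
theorem measurable_of_pairing {α : Type*} [MeasurableSpace α] {f : α → CountingMeasure d}
    (hf : ∀ h, Measurable fun a => pairing h (f a)) : Measurable f := by
  obtain ⟨D, hD, hI⟩ := exists_countable_isInducing d
  have := hD.to_subtype
  -- Countability of `D` is what makes the Borel σ-field of the product the product σ-field.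
  have hb : instMeasurableSpaceCountingMeasure d =
      MeasurableSpace.comap (fun φ (h : D) => pairing h.1 φ) inferInstance := by
    change borel _ = _
    rw [hI.eq_induced, borel_comap, ← BorelSpace.measurable_eq]
  refine Measurable.of_le_map ?_
  rw [hb, MeasurableSpace.comap_le_iff_le_map, MeasurableSpace.map_comp]
  exact measurable_iff_le_map.1 (measurable_pi_lambda _ fun h => hf h.1)

end CountingMeasure

instance (d : ℕ) : SecondCountableTopology (CountingMeasure₀ d) :=
  IsInducing.subtypeVal.secondCountableTopology

instance (d : ℕ) : TopologicalSpace.PseudoMetrizableSpace (CountingMeasure₀ d) :=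
  IsInducing.subtypeVal.pseudoMetrizableSpace

/-! ### Measurability of masses, integrals, shifts and supports -/

namespace CountingMeasure

variable {d : ℕ}

theorem measurable_measure_of_isClosed {K : Set (E d)} (hK : IsClosed K)
    (hb : Bornology.IsBounded K) : Measurable fun φ : CountingMeasure d => φ.toMeasure K := by
  have hδ : ∀ n : ℕ, (0 : ℝ) < 1 / ((n : ℝ) + 1) := fun n => Nat.one_div_pos_of_nat
  refine measurable_of_tendsto_metrizable
    (f := fun n φ => ∫⁻ x, bump (hδ n) hb x ∂φ.toMeasure) (fun n => ?_) ?_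
  · simp_rw [lintegral_eq_pairing]
    exact (measurable_pairing _).ennreal_ofReal
  · refine tendsto_pi_nhds.2 fun φ => ?_
    -- All the approximating functions live on `T`; restricting to it supplies the finite measure
    -- needed for the convergence result.
    set T := Metric.thickening 1 K
    have hT : MeasurableSet T := Metric.isOpen_thickening.measurableSet
    have hf : Fact (φ.toMeasure T < ∞) := ⟨φ.measure_lt_top hb.thickening⟩
    have h := tendsto_lintegral_thickenedIndicator_of_isClosed (φ.toMeasure.restrict T) hK hδ
      tendsto_one_div_add_atTop_nhds_zero_nat
    have hKT : K ∩ T = K := Set.inter_eq_left.2 (Metric.self_subset_thickening one_pos K)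
    rw [Measure.restrict_apply hK.measurableSet, hKT] at h
    refine h.congr fun n => ?_
    rw [setLIntegral_eq_of_support_subset]
    · rfl
    · intro x hx
      by_contra hxT
      refine hx ?_
      have hle : 1 / ((n : ℝ) + 1) ≤ 1 := by
        rw [div_le_one (by positivity)]
        linarith [(Nat.cast_nonneg n : (0 : ℝ) ≤ n)]
      have h0 := thickenedIndicator_zero (hδ n) K
        fun hx' => hxT (Metric.thickening_mono hle K hx')
      simpa using h0

theorem measurable_restrict_closedBall (n : ℕ) : Measurable fun φ : CountingMeasure d =>
    φ.toMeasure.restrict (Metric.closedBall 0 n) := by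
  have hf : ∀ φ : CountingMeasure d,
      IsFiniteMeasure (φ.toMeasure.restrict (Metric.closedBall 0 n)) := fun φ =>
    ⟨by simpa using φ.measure_lt_top Metric.isBounded_closedBall⟩
  refine Measurable.measure_of_isPiSystem (BorelSpace.measurable_eq.trans borel_eq_generateFrom_isClosed)
    isPiSystem_isClosed (fun s hs => ?_) ?_
  · simp_rw [Measure.restrict_apply hs.measurableSet]
    exact measurable_measure_of_isClosed (hs.inter Metric.isClosed_closedBall)
      (Metric.isBounded_closedBall.subset Set.inter_subset_right)
  · simp_rw [Measure.restrict_apply_univ]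
    exact measurable_measure_of_isClosed Metric.isClosed_closedBall Metric.isBounded_closedBall

/-- Integrals against a random counting measure depend measurably on parameters. -/
theorem measurable_lintegral {α : Type*} [MeasurableSpace α] {M : α → CountingMeasure d}
    (hM : Measurable M) {f : α → E d → ℝ≥0∞} (hf : Measurable (Function.uncurry f)) :
    Measurable fun a => ∫⁻ x, f a x ∂(M a).toMeasure := by
  have hmono : Monotone fun n : ℕ => Metric.closedBall (0 : E d) n := fun m n h =>
    Metric.closedBall_subset_closedBall (by exact_mod_cast h)
  have hsup : ∀ a, ∫⁻ x, f a x ∂(M a).toMeasure =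
      ⨆ n : ℕ, ∫⁻ x in Metric.closedBall (0 : E d) n, f a x ∂(M a).toMeasure := by
    intro a
    rw [← setLIntegral_iUnion_of_directed _ hmono.directed_le,
      Metric.iUnion_closedBall_nat, setLIntegral_univ]
  simp_rw [hsup]
  refine Measurable.iSup fun n => ?_
  -- The mass of the ball is finite for each `a` but not bounded in `a`. Truncating at level `k`
  -- gives finite kernels, and the supremum over `k` recovers the integral.
  let S : ℕ → Set α := fun k => {a | (M a).toMeasure (Metric.closedBall 0 n) ≤ k}
  have hS : ∀ k, MeasurableSet (S k) := fun k =>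
    ((measurable_measure_of_isClosed Metric.isClosed_closedBall Metric.isBounded_closedBall).comp
      hM) measurableSet_Iic
  classical
  let κ : ℕ → ProbabilityTheory.Kernel α (E d) := fun k =>
    ⟨fun a => if a ∈ S k then (M a).toMeasure.restrict (Metric.closedBall 0 n) else 0,
      Measurable.ite (hS k) ((measurable_restrict_closedBall n).comp hM) measurable_const⟩
  have hκ : ∀ k a, κ k a =
      if a ∈ S k then (M a).toMeasure.restrict (Metric.closedBall 0 n) else 0 := fun _ _ => rfl
  have hfin : ∀ k, ProbabilityTheory.IsFiniteKernel (κ k) := fun k =>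
    ⟨k, ENNReal.natCast_lt_top k, fun a => by
      rw [hκ]
      split_ifs with h
      · rw [Measure.restrict_apply_univ]
        exact h
      · simp⟩
  have heq : ∀ a, ∫⁻ x in Metric.closedBall (0 : E d) n, f a x ∂(M a).toMeasure =
      ⨆ k, ∫⁻ x, f a x ∂(κ k a) := by
    intro a
    obtain ⟨k, hk⟩ := (M a).nat_valued (Metric.closedBall 0 n) measurableSet_closedBall
      Metric.isBounded_closedBall
    refine le_antisymm (le_iSup_of_le k ?_) (iSup_le fun j => ?_)
    · rw [hκ, if_pos (show a ∈ S k from hk.le)]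
    · rw [hκ]
      split_ifs
      · exact le_rfl
      · simp
  simp_rw [heq]
  exact Measurable.iSup fun k => Measurable.lintegral_kernel_prod_right hf

theorem measurable_toMeasure : Measurable (toMeasure : CountingMeasure d → _) := by
  refine Measure.measurable_of_measurable_coe _ fun s hs => ?_
  simp_rw [← lintegral_indicator_one hs]
  exact measurable_lintegral measurable_id
    ((measurable_one.indicator hs).comp measurable_snd)

theorem measurable_of_lintegral {α : Type*} [MeasurableSpace α] {f : α → CountingMeasure d}
    (hf : ∀ h : C_c(E d, ℝ≥0), Measurable fun a => ∫⁻ x, h x ∂(f a).toMeasure) :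
    Measurable f := by
  refine measurable_of_pairing fun h => ?_
  have := (hf h).ennreal_toReal
  simpa only [lintegral_eq_pairing, ENNReal.toReal_ofReal (pairing_nonneg _ _)] using this

theorem lintegral_shift (φ : CountingMeasure d) (t : E d) {f : E d → ℝ≥0∞} (hf : Measurable f) :
    ∫⁻ x, f x ∂(φ.shift t).toMeasure = ∫⁻ x, f (x - t) ∂φ.toMeasure :=
  lintegral_map hf (measurable_id.sub_const t)

theorem measurable_shift : Measurable fun p : E d × CountingMeasure d => p.2.shift p.1 := by
  refine measurable_of_lintegral fun h => ?_
  have hh : Measurable fun x => (h x : ℝ≥0∞) := h.continuous.measurable.coe_nnreal_ennreal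
  simp_rw [lintegral_shift _ _ hh]
  exact measurable_lintegral measurable_snd
    (hh.comp (measurable_snd.sub (measurable_fst.comp measurable_fst)))

theorem measurable_measure_singleton :
    Measurable fun p : CountingMeasure d × E d => p.1.toMeasure {p.2} := by
  simp_rw [← lintegral_indicator_one (measurableSet_singleton _)]
  refine measurable_lintegral measurable_fst ?_
  have h : MeasurableSet {q : (CountingMeasure d × E d) × E d | q.2 = q.1.2} :=
    measurableSet_eq_fun measurable_snd (measurable_snd.comp measurable_fst)
  exact measurable_one.indicator h

theorem countable_points (φ : CountingMeasure d) : φ.points.Countable := by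
  have h : φ.points = ⋃ n : ℕ, Metric.closedBall (0 : E d) n ∩ φ.points := by
    rw [← Set.iUnion_inter, Metric.iUnion_closedBall_nat, Set.univ_inter]
  rw [h]
  exact Set.countable_iUnion fun n =>
    (φ.finite_inter_points measurableSet_closedBall Metric.isBounded_closedBall).countable

theorem tendsto_measure_closedBall_singleton (μ : Measure (E d)) [IsFiniteMeasureOnCompacts μ]
    (x : E d) : Tendsto (fun r => μ (Metric.closedBall x r)) (𝓝[>] 0) (𝓝 (μ {x})) := by
  have h := tendsto_measure_cthickening_of_isCompact (μ := μ) (isCompact_singleton (x := x))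
  refine (h.mono_left nhdsWithin_le_nhds).congr' ?_
  filter_upwards [self_mem_nhdsWithin] with r hr
  rw [Metric.cthickening_singleton x (le_of_lt hr)]

/-- A counting measure is purely atomic. -/
theorem measure_compl_points (φ : CountingMeasure d) : φ.toMeasure φ.pointsᶜ = 0 := by
  refine measure_null_of_locally_null _ fun x hx => ?_
  have h0 : φ.toMeasure {x} = 0 := by simpa [points] using hx
  -- Balls shrinking to a non-atom have mass tending to $0$, and an integer mass below $1$ is $0$.
  have hlim := tendsto_measure_closedBall_singleton φ.toMeasure x
  rw [h0] at hlim
  obtain ⟨r, hr, hr0⟩ := ((hlim.eventually (gt_mem_nhds zero_lt_one)).and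
    self_mem_nhdsWithin).exists
  refine ⟨Metric.closedBall x r,
    mem_nhdsWithin_of_mem_nhds (Metric.closedBall_mem_nhds x hr0), ?_⟩
  obtain ⟨k, hk⟩ := φ.nat_valued _ measurableSet_closedBall
    (Metric.isBounded_closedBall (x := x) (r := r))
  rw [hk] at hr ⊢
  norm_cast at hr ⊢
  omega

theorem ae_mem_points (φ : CountingMeasure d) : ∀ᵐ x ∂φ.toMeasure, x ∈ φ.points :=
  φ.measure_compl_points

/-- Dividing by multiplicities turns an integral over the support into one against `φ` itself, so
that `measurable_lintegral` yields measurability of the support map. -/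
theorem lintegral_supp (φ : CountingMeasure d) (f : E d → ℝ≥0∞) :
    ∫⁻ x, f x ∂φ.supp.toMeasure = ∫⁻ x, f x * (φ.toMeasure {x})⁻¹ ∂φ.toMeasure := by
  have hr : φ.toMeasure.restrict φ.points = φ.toMeasure :=
    Measure.restrict_eq_self_of_ae_mem φ.ae_mem_points
  conv_rhs => rw [← hr]
  simp only [supp, lintegral_countable _ φ.countable_points, Measure.count_singleton, mul_one]
  refine tsum_congr fun x => ?_
  have h1 : φ.toMeasure {x.1} ≠ ∞ := (φ.measure_lt_top Bornology.isBounded_singleton).ne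
  have hx : φ.toMeasure.restrict φ.points {x.1} = φ.toMeasure {x.1} := by rw [hr]
  rw [hx, mul_assoc, ENNReal.inv_mul_cancel x.2 h1, mul_one]

theorem measurable_supp : Measurable (supp : CountingMeasure d → _) := by
  refine measurable_of_lintegral fun h => ?_
  simp_rw [lintegral_supp]
  have hh : Measurable fun x => (h x : ℝ≥0∞) := h.continuous.measurable.coe_nnreal_ennreal
  exact measurable_lintegral measurable_id
    ((hh.comp measurable_snd).mul measurable_measure_singleton.inv)

theorem shift_add (s t : E d) (φ : CountingMeasure d) : φ.shift (s + t) = (φ.shift t).shift s := by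
  refine CountingMeasure.ext ?_
  change φ.toMeasure.map _ = (φ.toMeasure.map _).map _
  have hs : ∀ s : E d, Measurable fun x : E d => x - s := fun s => measurable_id.sub_const s
  rw [Measure.map_map (hs s) (hs t)]
  congr 1
  ext1 x
  simp only [Function.comp_apply]
  abel

theorem shift_zero (φ : CountingMeasure d) : φ.shift 0 = φ := by
  refine CountingMeasure.ext ?_
  change φ.toMeasure.map _ = _
  simp

theorem measurableSet_zero_mem : MeasurableSet {φ : CountingMeasure d | (0 : E d) ∈ φ.points} :=
  ((Measure.measurable_coe (measurableSet_singleton 0)).comp measurable_toMeasure)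
    (measurableSet_singleton 0).compl

end CountingMeasure

open CountingMeasure

/-! ### Iterates of the point-map and their measurability -/

namespace PointMap

variable {d : ℕ} (g : PointMap d)

theorem measurable_ext : Measurable g.ext :=
  g.measurable_toFun.comp ((measurable_supp.comp measurable_subtype_coe).subtype_mk)

theorem theta_zero (φ : CountingMeasure₀ d) : g.theta 0 φ = φ := Subtype.ext φ.1.shift_zero

theorem theta_one_val (φ : CountingMeasure₀ d) : (g.theta 1 φ).1 = φ.1.shift (g.ext φ) := by
  have h : shiftAt φ.1 ⟨0, φ.2⟩ = φ := Subtype.ext φ.1.shift_zero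
  change φ.1.shift (g.ext (shiftAt φ.1 ⟨0, φ.2⟩) + 0) = _
  rw [h, add_zero]

theorem shiftAt_pointShift (φ : CountingMeasure d) (x : φ.points) :
    shiftAt φ (g.pointShift φ x) = g.theta 1 (shiftAt φ x) := by
  refine Subtype.ext ?_
  rw [theta_one_val]
  exact shift_add _ _ _

theorem theta_succ (n : ℕ) (φ : CountingMeasure₀ d) :
    g.theta (n + 1) φ = g.theta 1 (g.theta n φ) := by
  rw [theta, iter, Function.iterate_succ_apply', shiftAt_pointShift]
  rfl

theorem measurable_theta_one : Measurable (g.theta 1) := by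
  refine measurable_comap_iff.2 ?_
  simp only [Function.comp_def, theta_one_val]
  exact measurable_shift.comp (g.measurable_ext.prodMk measurable_subtype_coe)

theorem measurable_theta (n : ℕ) : Measurable (g.theta n) := by
  induction n with
  | zero => 
    simp_rw [funext g.theta_zero]
    exact measurable_id
  | succ n ih =>
    simp_rw [funext fun φ => g.theta_succ n φ]
    exact g.measurable_theta_one.comp ih

/-- Compatibility with shifts links the orbit of the origin in a recentred configuration to the
orbit of `x` in `φ`, where the finite-orbit hypothesis applies. -/
theorem theta_shiftAt (n : ℕ) (φ : CountingMeasure d) (x : φ.points) :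
    g.theta n (shiftAt φ x) = shiftAt φ ((g.pointShift φ)^[n] x) := by
  induction n with
  | zero => exact g.theta_zero _
  | succ n ih => rw [theta_succ, ih, Function.iterate_succ_apply', shiftAt_pointShift]

end PointMap

/-! ### Compact sets of counting measures -/

section bump

variable {d : ℕ} {δ : ℝ} (hδ : 0 < δ) {K : Set (E d)} (hK : Bornology.IsBounded K)

theorem measure_le_lintegral_bump (μ : Measure (E d)) (hKm : MeasurableSet K) :
    μ K ≤ ∫⁻ x, bump hδ hK x ∂μ := by
  rw [← lintegral_indicator_one hKm]
  refine lintegral_mono fun x => ?_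
  by_cases hx : x ∈ K
  · simp [hx, bump_eq_one hδ hK hx]
  · simp [hx]

theorem lintegral_bump_le (μ : Measure (E d)) {T : Set (E d)} (hT : MeasurableSet T)
    (h : Metric.thickening δ K ⊆ T) : ∫⁻ x, bump hδ hK x ∂μ ≤ μ T := by
  rw [← lintegral_indicator_one hT]
  refine lintegral_mono fun x => ?_
  by_cases hx : x ∈ T
  · simpa [hx] using bump_le_one hδ hK x
  · simp [bump_eq_zero hδ hK fun h' => hx (h h')]

end bump

namespace CountingMeasure

variable {d : ℕ}

theorem measure_le_pairing_cutoff (φ : CountingMeasure d) (n : ℕ) :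
    φ.toMeasure (Metric.closedBall 0 n) ≤ ENNReal.ofReal (pairing (cutoff d n) φ) := by
  rw [← lintegral_eq_pairing]
  exact measure_le_lintegral_bump _ _ _ measurableSet_closedBall

/-- Bounds on the countably many cutoffs thus control every test function. -/
theorem exists_le_mul_cutoff (h : C_c(E d, ℝ≥0)) :
    ∃ (C : ℝ≥0) (n : ℕ), ∀ x, h x ≤ (C • cutoff d n) x := by
  obtain ⟨r, hr⟩ := h.hasCompactSupport.isBounded.exists_norm_le
  obtain ⟨n, hn⟩ := exists_nat_ge r
  obtain ⟨C, hC⟩ := (isCompact_closedBall (0 : E d) n).bddAbove_image h.continuous.continuousOn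
  refine ⟨C, n, fun x => ?_⟩
  by_cases hx : ‖x‖ ≤ n
  · have h1 : h x ≤ C := hC ⟨x, by simpa using hx, rfl⟩
    simpa [cutoff_eq_one hx] using h1
  · have h0 : h x = 0 := by
      by_contra h0
      exact hx ((hr x (subset_tsupport _ h0)).trans hn)
    rw [h0]
    exact zero_le

/-- A measure which near each point reduces to an atom of integer mass takes integer values. -/
theorem exists_nat_measure_eq {μ : Measure (E d)}
    (h : ∀ x, ∃ δ > 0, ∃ n : ℕ, μ (Metric.closedBall x δ) = n ∧ μ {x} = n)
    {B : Set (E d)} (hb : Bornology.IsBounded B) : ∃ k : ℕ, μ B = k := by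
  classical
  choose δ hδ n hn hn' using h
  obtain ⟨t, -, ht⟩ := hb.isCompact_closure.elim_nhds_subcover (fun x => Metric.closedBall x (δ x))
    fun x _ => Metric.closedBall_mem_nhds x (hδ x)
  -- Each punctured ball is null, so only the finitely many centres carry mass in `B`.
  have hnull : μ (B \ (t : Set (E d))) = 0 := by
    refine measure_mono_null (t := ⋃ x ∈ t, Metric.closedBall x (δ x) \ {x}) ?_ ?_
    · rintro y ⟨hy, hyt⟩
      obtain ⟨x, hx, hyx⟩ := Set.mem_iUnion₂.1 (ht (subset_closure hy))
      refine Set.mem_iUnion₂.2 ⟨x, hx, hyx, ?_⟩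
      rintro rfl
      exact hyt hx
    · refine (measure_biUnion_null_iff t.countable_toSet).2 fun x _ => ?_
      rw [measure_sdiff (by simpa using (hδ x).le) (measurableSet_singleton x).nullMeasurableSet
        (by simp [hn']), hn, hn', tsub_self]
  refine ⟨∑ x ∈ t with x ∈ B, n x, ?_⟩
  have hB : B ∩ (t : Set (E d)) = ((t.filter (· ∈ B) : Finset (E d)) : Set (E d)) := by
    ext x
    simp [and_comm]
  rw [← measure_inter_add_sdiff B t.measurableSet, hnull, add_zero, hB, ← sum_measure_singleton]
  push_cast
  exact Finset.sum_congr rfl fun x _ => hn' x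

/-- The mass of a small ball is eventually constant along a vaguely convergent ultrafilter. -/
theorem exists_nat_eventually_measure_eq {U : Ultrafilter (CountingMeasure d)}
    {Λ : C_c(E d, ℝ≥0) → ℝ} (hΛ : ∀ h, Tendsto (pairing h) U (𝓝 (Λ h))) {B : Set (E d)}
    (hB : MeasurableSet B) (hb : Bornology.IsBounded B) :
    ∃ n : ℕ, ∀ᶠ ψ : CountingMeasure d in U, ψ.toMeasure B = n := by
  obtain ⟨r, hr⟩ := hb.exists_norm_le
  obtain ⟨k, hk⟩ := exists_nat_ge r
  obtain ⟨m, hm⟩ := exists_nat_ge (Λ (cutoff d k) + 1)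
  -- Only finitely many integer values are eventually possible, so the ultrafilter selects one of
  -- them.
  have hev : ∀ᶠ ψ : CountingMeasure d in U, ∃ n ∈ Set.Iic m, ψ.toMeasure B = n := by
    filter_upwards [(hΛ (cutoff d k)).eventually (gt_mem_nhds (lt_add_one _))] with ψ hψ
    obtain ⟨n, hn⟩ := ψ.nat_valued B hB hb
    refine ⟨n, ?_, hn⟩
    have h1 : ψ.toMeasure B ≤ ENNReal.ofReal m :=
      (measure_mono fun x hx => by simpa using (hr x hx).trans hk).trans
        ((ψ.measure_le_pairing_cutoff k).trans (ENNReal.ofReal_le_ofReal (hψ.le.trans hm)))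
    rw [hn, ENNReal.ofReal_natCast] at h1
    exact_mod_cast h1
  obtain ⟨n, -, hn⟩ := (Ultrafilter.eventually_exists_mem_iff (Set.finite_Iic m)).1 hev
  exact ⟨n, hn⟩

/-- Near each point, a vague limit of counting measures is an atom of integer mass. -/
theorem exists_closedBall_of_tendsto {U : Ultrafilter (CountingMeasure d)}
    {Λ : C_c(E d, ℝ≥0) → ℝ} (hΛ : ∀ h, Tendsto (pairing h) U (𝓝 (Λ h))) {μ : Measure (E d)}
    [IsFiniteMeasureOnCompacts μ] (hμ : ∀ h : C_c(E d, ℝ≥0), ∫⁻ x, h x ∂μ = ENNReal.ofReal (Λ h))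
    (x : E d) : ∃ δ > 0, ∃ n : ℕ, μ (Metric.closedBall x δ) = n ∧ μ {x} = n ∧
      ∀ᶠ ψ : CountingMeasure d in U, ψ.toMeasure (Metric.closedBall x δ) = n := by
  have hδ : ∀ k : ℕ, (0 : ℝ) < (1 / 2) ^ k := fun k => by positivity
  have hδ' : ∀ k : ℕ, (0 : ℝ) < (1 / 2) ^ (k + 1) := fun k => by positivity
  have hsucc : ∀ k : ℕ, Metric.thickening ((1 / 2) ^ (k + 1))
      (Metric.closedBall x ((1 / 2) ^ (k + 1))) ⊆ Metric.closedBall x ((1 / 2) ^ k) := by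
    intro k
    rw [thickening_closedBall (hδ' k) (hδ' k).le]
    refine Metric.ball_subset_closedBall.trans (Metric.closedBall_subset_closedBall ?_)
    rw [pow_succ]
    linarith
  choose n hn using fun k : ℕ => exists_nat_eventually_measure_eq hΛ
    (measurableSet_closedBall (x := x) (ε := (1 / 2) ^ k)) Metric.isBounded_closedBall
  have hanti : ∀ j k, j ≤ k → n k ≤ n j := by
    intro j k hjk
    obtain ⟨ψ, hj, hk⟩ := ((hn j).and (hn k)).exists
    have h := measure_mono (μ := ψ.toMeasure) (Metric.closedBall_subset_closedBall (x := x)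
      (pow_le_pow_of_le_one (by norm_num : (0 : ℝ) ≤ 1 / 2) (by norm_num) hjk))
    rw [hj, hk] at h
    exact_mod_cast h
  -- A nonincreasing sequence of naturals is constant from the index of its minimum on.
  obtain ⟨_, ⟨k₀, rfl⟩, hmin⟩ :=
    wellFounded_lt.has_min (Set.range n) (Set.range_nonempty n)
  have hconst : ∀ k, k₀ ≤ k → n k = n k₀ := fun k hk =>
    le_antisymm (hanti _ _ hk) (not_lt.1 (hmin _ ⟨k, rfl⟩))
  let b : ℕ → C_c(E d, ℝ≥0) := fun k =>
    bump (hδ' k) (Metric.isBounded_closedBall (x := x) (r := (1 / 2) ^ (k + 1)))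
  -- The integral of `b k` against `ψ` is squeezed between the masses of two consecutive balls,
  -- which are eventually both `n k₀`; the value passes to the limit.
  have hb : ∀ k, k₀ ≤ k → ∫⁻ y, b k y ∂μ = n k₀ := by
    intro k hk
    have hev : ∀ᶠ ψ in U, pairing (b k) ψ = n k₀ := by
      filter_upwards [hn k, hn (k + 1)] with ψ h1 h2
      have h3 : ∫⁻ y, b k y ∂ψ.toMeasure = n k₀ := by
        refine le_antisymm ?_ ?_
        · rw [← hconst k hk, ← h1]
          exact lintegral_bump_le _ _ _ measurableSet_closedBall (hsucc k)
        · rw [← hconst (k + 1) (hk.trans k.le_succ), ← h2]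
          exact measure_le_lintegral_bump _ _ _ measurableSet_closedBall
      rw [lintegral_eq_pairing] at h3
      have h4 := congrArg ENNReal.toReal h3
      rwa [ENNReal.toReal_ofReal (pairing_nonneg _ _), ENNReal.toReal_natCast] at h4
    rw [hμ, tendsto_nhds_unique (hΛ (b k))
      (tendsto_const_nhds.congr' (hev.mono fun ψ h => h.symm)), ENNReal.ofReal_natCast]
  have hball : ∀ k, k₀ + 1 ≤ k → μ (Metric.closedBall x ((1 / 2) ^ k)) = n k₀ := by
    intro k hk
    refine le_antisymm ?_ ?_
    · obtain ⟨j, rfl⟩ : ∃ j, k = j + 1 := ⟨k - 1, by omega⟩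
      rw [← hb j (by omega)]
      exact measure_le_lintegral_bump _ _ _ measurableSet_closedBall
    · rw [← hb k (by omega)]
      exact lintegral_bump_le _ _ _ measurableSet_closedBall (hsucc k)
  refine ⟨(1 / 2) ^ (k₀ + 1), hδ _, n k₀, hball _ le_rfl, ?_, ?_⟩
  · have h1 : Tendsto (fun k : ℕ => μ (Metric.closedBall x ((1 / 2) ^ k))) atTop (𝓝 (μ {x})) :=
      (tendsto_measure_closedBall_singleton μ x).comp (tendsto_nhdsWithin_iff.2
        ⟨tendsto_pow_atTop_nhds_zero_of_lt_one (by norm_num) (by norm_num),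
          Eventually.of_forall hδ⟩)
    refine tendsto_nhds_unique h1 (tendsto_const_nhds.congr' ?_)
    filter_upwards [eventually_ge_atTop (k₀ + 1)] with k hk using (hball k hk).symm
  · filter_upwards [hn (k₀ + 1)] with ψ hψ
    rw [hψ, hconst _ k₀.le_succ]

end CountingMeasure

/-- Sets of counting measures with locally bounded mass are compact. -/
theorem isCompact_setOf_pairing_cutoff_le {d : ℕ} (c : ℕ → ℝ) :
    IsCompact {ψ : CountingMeasure₀ d | ∀ r, pairing (cutoff d r) ψ.1 ≤ c r} := by
  refine isCompact_iff_ultrafilter_le_nhds.2 fun V hV => ?_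
  rw [le_principal_iff] at hV
  let U : Ultrafilter (CountingMeasure d) := V.map Subtype.val
  have hU : ∀ r, ∀ᶠ ψ in U, pairing (cutoff d r) ψ ≤ c r := fun r =>
    eventually_map.2 (mem_of_superset hV fun ψ hψ => hψ r)
  have hU0 : ∀ᶠ ψ : CountingMeasure d in U, (0 : E d) ∈ ψ.points :=
    eventually_map.2 (Eventually.of_forall fun ψ => ψ.2)
  have hlim : ∀ h, ∃ L : ℝ≥0, Tendsto (pairing h) (U : Filter (CountingMeasure d)) (𝓝 (L : ℝ)) := by
    intro h
    obtain ⟨C, n, hC⟩ := exists_le_mul_cutoff h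
    have hmem : ∀ᶠ ψ in U, pairing h ψ ∈ Set.Icc 0 (C * c n) := by
      filter_upwards [hU n] with ψ hψ
      refine ⟨pairing_nonneg _ _, (pairing_mono hC ψ).trans ?_⟩
      rw [pairing_smul]
      gcongr
    obtain ⟨L, hL, hL'⟩ := isCompact_Icc.ultrafilter_le_nhds (U.map (pairing h))
      (le_principal_iff.2 hmem)
    exact ⟨⟨L, hL.1⟩, hL'⟩
  choose L hL using hlim
  let Λ : C_c(E d, ℝ≥0) →ₗ[ℝ≥0] ℝ≥0 :=
    { toFun := L
      map_add' := fun f h => NNReal.coe_injective <| tendsto_nhds_unique (hL (f + h)) <|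
        ((hL f).add (hL h)).congr fun φ => (pairing_add f h φ).symm
      map_smul' := fun a h => NNReal.coe_injective <| tendsto_nhds_unique (hL (a • h)) <|
        ((hL h).const_mul (a : ℝ)).congr fun φ => (pairing_smul a h φ).symm }
  let μ := NNRealRMK.rieszMeasure Λ
  have hμ : ∀ h : C_c(E d, ℝ≥0), ∫⁻ x, h x ∂μ = ENNReal.ofReal (L h) := fun h => by
    rw [NNRealRMK.lintegral_rieszMeasure, ENNReal.ofReal_coe_nnreal]
    rfl
  have hloc := exists_closedBall_of_tendsto hL hμ
  let φ : CountingMeasure d := ⟨μ, fun B _ hb => exists_nat_measure_eq (fun x => by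
    obtain ⟨δ, hδ, n, h1, h2, -⟩ := hloc x
    exact ⟨δ, hδ, n, h1, h2⟩) hb⟩
  have hφ : ∀ h, pairing h φ = L h := NNRealRMK.integral_rieszMeasure Λ
  -- Each `ψ` has mass at least one in the ball around the origin, and in the limit all the mass of
  -- that ball sits at its centre.
  have h0 : (0 : E d) ∈ φ.points := by
    obtain ⟨δ, hδ, n, -, h2, h3⟩ := hloc 0
    obtain ⟨ψ, hψ, hψ'⟩ := (hU0.and h3).exists
    change μ {0} ≠ 0
    rw [h2, ← hψ']
    exact (zero_lt_one.trans_le ((one_le_of_mem hψ).trans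
      (measure_mono (by simpa using hδ.le)))).ne'
  refine ⟨⟨φ, h0⟩, fun r => ?_, ?_⟩
  · exact le_of_tendsto ((hφ (cutoff d r)).symm ▸ hL (cutoff d r)) (hU r)
  · rw [nhds_subtype_eq_comap]
    refine tendsto_iff_comap.1 (le_nhds_iff_pairing.2 fun h => ?_ : (U : Filter _) ≤ 𝓝 φ)
    exact hφ h ▸ hL h

/-! ### Stationarity, the mean measure and the Palm distribution -/

/-- The unit cube, the window which defines the intensity. -/
def unitCube (d : ℕ) : Set (E d) := {x : E d | ∀ i, x i ∈ Set.Ico (0 : ℝ) 1}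

theorem volume_unitCube (d : ℕ) : volume (unitCube d) = 1 := by
  have h := (EuclideanSpace.volume_preserving_symm_measurableEquiv_toLp (Fin d)).measure_preimage_equiv
    (Set.univ.pi fun _ => Set.Ico (0 : ℝ) 1)
  rw [Real.volume_pi_Ico] at h
  simp only [sub_zero, ENNReal.ofReal_one, Finset.prod_const_one] at h
  rw [← h]
  congr 1
  ext x
  simp [unitCube]

theorem measurableSet_unitCube (d : ℕ) : MeasurableSet (unitCube d) := by
  simp only [unitCube, Set.ofPred_forall]
  exact MeasurableSet.iInter fun i =>
    (EuclideanSpace.proj (𝕜 := ℝ) i).continuous.measurable measurableSet_Ico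

/-- The mean measure of a random counting measure. -/
def meanMeasure {d : ℕ} {Ω : Type*} [MeasurableSpace Ω] (ℙ : Measure Ω)
    (Φ : Ω → CountingMeasure d) : Measure (E d) := ℙ.bind fun ω => (Φ ω).toMeasure

namespace IsStationaryPointProcess

variable {d : ℕ} {Ω : Type*} [MeasurableSpace Ω] {θ : E d → Ω → Ω} {ℙ : Measure Ω}
  {Φ : Ω → CountingMeasure d} (hΦ : IsStationaryPointProcess θ ℙ Φ)

include hΦ

theorem meanMeasure_apply {s : Set (E d)} (hs : MeasurableSet s) :
    meanMeasure ℙ Φ s = ∫⁻ ω, (Φ ω).toMeasure s ∂ℙ :=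
  Measure.bind_apply hs (measurable_toMeasure.comp hΦ.measurable).aemeasurable

theorem isAddLeftInvariant_meanMeasure : (meanMeasure ℙ Φ).IsAddLeftInvariant := by
  refine ⟨fun t => Measure.ext fun s hs => ?_⟩
  have hm : Measurable fun x : E d => t + x := measurable_const_add t
  rw [Measure.map_apply hm hs, hΦ.meanMeasure_apply (hm hs), hΦ.meanMeasure_apply hs]
  have hθ : Measurable (θ (-t)) := hΦ.flow.measurable.comp measurable_prodMk_left
  have hmeas : Measurable fun ω => (Φ ω).toMeasure s :=
    (Measure.measurable_coe hs).comp (measurable_toMeasure.comp hΦ.measurable)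
  conv_rhs => rw [← hΦ.stationary (-t), lintegral_map hmeas hθ]
  refine lintegral_congr fun ω => ?_
  rw [hΦ.compatible]
  have hm' : Measurable fun x : E d => x - -t := measurable_id.sub_const (-t)
  change _ = (Φ ω).toMeasure.map (fun x => x - -t) s
  rw [Measure.map_apply hm' hs]
  congr 1
  ext x
  simp [add_comm]

theorem meanMeasure_unitCube : meanMeasure ℙ Φ (unitCube d) = intensity ℙ Φ :=
  hΦ.meanMeasure_apply (measurableSet_unitCube d)

theorem isLocallyFiniteMeasure_meanMeasure (hfin : intensity ℙ Φ ≠ ∞) :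
    IsLocallyFiniteMeasure (meanMeasure ℙ Φ) := by
  have := hΦ.isAddLeftInvariant_meanMeasure
  refine ⟨fun x => ?_⟩
  -- Translation by `a` moves `x` to the centre of the unit cube.
  let a : E d := WithLp.toLp 2 fun i => 1 / 2 - x i
  refine ⟨(fun y => a + y) ⁻¹' unitCube d, ?_, ?_⟩
  · have hopen : IsOpen {y : E d | ∀ i, (a + y) i ∈ Set.Ioo (0 : ℝ) 1} := by
      simp only [Set.ofPred_forall]
      refine isOpen_iInter_of_finite fun i => isOpen_Ioo.preimage ?_
      exact (EuclideanSpace.proj (𝕜 := ℝ) i).continuous.comp (continuous_const_add a)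
    refine mem_of_superset (hopen.mem_nhds fun i => ?_) fun y hy i => Set.Ioo_subset_Ico_self (hy i)
    simp only [a, PiLp.add_apply, sub_add_cancel]
    norm_num
  · rw [measure_preimage_add, hΦ.meanMeasure_unitCube]
    exact hfin.lt_top

/-- Campbell's formula for the mean measure. -/
theorem meanMeasure_eq (hfin : intensity ℙ Φ ≠ ∞) :
    meanMeasure ℙ Φ = intensity ℙ Φ • volume := by
  have h1 := hΦ.isAddLeftInvariant_meanMeasure
  have h2 := hΦ.isLocallyFiniteMeasure_meanMeasure hfin
  -- Uniqueness of Haar measure; the unit cube, of volume $1$, identifies the constant.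
  have h3 := Measure.isAddLeftInvariant_eq_smul (meanMeasure ℙ Φ) volume
  have h4 := hΦ.meanMeasure_unitCube
  rw [h3, Measure.smul_apply, volume_unitCube] at h4
  rw [ENNReal.smul_def, smul_eq_mul, mul_one] at h4
  refine h3.trans ?_
  rw [← h4]
  rfl

theorem measurable_palmKernel {B : Set (E d)} (hB : MeasurableSet B) :
    Measurable fun ω => ((Φ ω).toMeasure.restrict B).map (fun t => θ t ω) := by
  refine Measure.measurable_of_measurable_coe _ fun s hs => ?_
  have hθ : ∀ ω, Measurable fun t => θ t ω := fun ω =>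
    hΦ.flow.measurable.comp measurable_prodMk_right
  have h : MeasurableSet {p : Ω × E d | θ p.2 p.1 ∈ s ∧ p.2 ∈ B} :=
    ((hΦ.flow.measurable.comp measurable_swap) hs).inter (measurable_snd hB)
  have heq : ∀ ω, ((Φ ω).toMeasure.restrict B).map (fun t => θ t ω) s =
      ∫⁻ t, {p : Ω × E d | θ p.2 p.1 ∈ s ∧ p.2 ∈ B}.indicator 1 (ω, t) ∂(Φ ω).toMeasure := by
    intro ω
    rw [Measure.map_apply (hθ ω) hs, Measure.restrict_apply (hθ ω hs),
      ← lintegral_indicator_one ((hθ ω hs).inter hB)]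
    rfl
  simp_rw [heq]
  exact measurable_lintegral hΦ.measurable (measurable_one.indicator h)

theorem isProbabilityMeasure_palm (hpos : intensity ℙ Φ ≠ 0) (hfin : intensity ℙ Φ ≠ ∞)
    {B : Set (E d)} (hB : MeasurableSet B) (hB0 : volume B ≠ 0) (hB1 : volume B ≠ ∞) :
    IsProbabilityMeasure (palm θ ℙ Φ B) := by
  have hθ : ∀ ω, Measurable fun t => θ t ω := fun ω =>
    hΦ.flow.measurable.comp measurable_prodMk_right
  refine ⟨?_⟩
  rw [palm, Measure.smul_apply, Measure.bind_apply MeasurableSet.univ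
    (hΦ.measurable_palmKernel hB).aemeasurable]
  simp only [Measure.map_apply (hθ _) MeasurableSet.univ, Set.preimage_univ,
    Measure.restrict_apply_univ]
  rw [← hΦ.meanMeasure_apply hB, hΦ.meanMeasure_eq hfin, Measure.smul_apply]
  exact ENNReal.inv_mul_cancel (mul_ne_zero hpos hB0) (ENNReal.mul_ne_top hfin hB1)

/-- A property of all recentred configurations of almost every realization holds almost surely
under the Palm measure. -/
theorem ae_palm_of_ae {B : Set (E d)} (hB : MeasurableSet B) {A : Set (CountingMeasure d)}
    (hA : MeasurableSet A)
    (h : ∀ᵐ φ ∂(ℙ.map Φ), ∀ x : φ.points, φ.shift x ∈ A) :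
    ∀ᵐ φ ∂((palm θ ℙ Φ B).map Φ), φ ∈ A := by
  have hθ : ∀ ω, Measurable fun t => θ t ω := fun ω =>
    hΦ.flow.measurable.comp measurable_prodMk_right
  refine (ae_map_iff hΦ.measurable.aemeasurable hA).2 ?_
  refine Measure.ae_smul_measure ?_ _
  have hm : MeasurableSet (Φ ⁻¹' Aᶜ) := hΦ.measurable hA.compl
  change ℙ.bind _ (Φ ⁻¹' Aᶜ) = 0
  rw [Measure.bind_apply hm (hΦ.measurable_palmKernel hB).aemeasurable]
  refine (lintegral_eq_zero_iff
    ((Measure.measurable_coe hm).comp (hΦ.measurable_palmKernel hB))).2 ?_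
  filter_upwards [ae_of_ae_map hΦ.measurable.aemeasurable h] with ω hω
  change ((Φ ω).toMeasure.restrict B).map (fun t => θ t ω) (Φ ⁻¹' Aᶜ) = 0
  rw [Measure.map_apply (hθ ω) hm]
  -- The integral over the window only sees the points of `Φ ω`, where the recentred configuration
  -- lies in `A`.
  refine measure_mono_null (t := (Φ ω).pointsᶜ) (fun t ht hp => ht ?_)
    (Measure.absolutelyContinuous_of_le Measure.restrict_le_self (measure_compl_points _))
  rw [hΦ.compatible]
  exact hω ⟨t, hp⟩

/-- Recentring at a point puts a point at the origin, so the Palm law is carried by $\mathbf N^0$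
and the `comap` loses no mass. -/
theorem map_val_palmDistribution {B : Set (E d)} (hB : MeasurableSet B) :
    (palmDistribution θ ℙ Φ B).map Subtype.val = (palm θ ℙ Φ B).map Φ := by
  have hemb : MeasurableEmbedding (Subtype.val : CountingMeasure₀ d → CountingMeasure d) :=
    .subtype_coe measurableSet_zero_mem
  rw [palmDistribution, hemb.map_comap]
  refine Measure.restrict_eq_self_of_ae_mem (hΦ.ae_palm_of_ae hB hemb.measurableSet_range ?_)
  exact Eventually.of_forall fun φ x => ⟨shiftAt φ x, rfl⟩

theorem isProbabilityMeasure_palmDistribution (hpos : intensity ℙ Φ ≠ 0)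
    (hfin : intensity ℙ Φ ≠ ∞) {B : Set (E d)} (hB : MeasurableSet B) (hB0 : volume B ≠ 0)
    (hB1 : volume B ≠ ∞) : IsProbabilityMeasure (palmDistribution θ ℙ Φ B) := by
  have := hΦ.isProbabilityMeasure_palm hpos hfin hB hB0 hB1
  have h := Measure.isProbabilityMeasure_map (μ := palm θ ℙ Φ B) hΦ.measurable.aemeasurable
  rw [← hΦ.map_val_palmDistribution hB] at h
  exact Measure.isProbabilityMeasure_of_map Subtype.val

/-! ### Uniform tightness from finite orbits -/

/-- The mass which the orbit of a typical point sees in a bounded set is almost surely bounded. -/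
theorem ae_palmDistribution_exists_bound {g : PointMap d} (hg : HasFiniteOrbits g ℙ Φ)
    {B : Set (E d)} (hB : MeasurableSet B) (h : C_c(E d, ℝ≥0)) :
    ∀ᵐ φ ∂(palmDistribution θ ℙ Φ B), ∃ k : ℕ, ∀ n, pairing h (g.theta n φ).1 ≤ k := by
  let S : Set (CountingMeasure₀ d) := {φ | ∃ k : ℕ, ∀ n, pairing h (g.theta n φ).1 ≤ k}
  have hS : MeasurableSet S := by
    simp only [S, Set.ofPred_exists, Set.ofPred_forall]
    exact MeasurableSet.iUnion fun k => MeasurableSet.iInter fun n =>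
      ((measurable_pairing h).comp (measurable_subtype_coe.comp (g.measurable_theta n)))
        measurableSet_Iic
  have hemb : MeasurableEmbedding (Subtype.val : CountingMeasure₀ d → CountingMeasure d) :=
    .subtype_coe measurableSet_zero_mem
  have hS' := hemb.measurableSet_image.2 hS
  have key := hΦ.ae_palm_of_ae hB hS' (hg.mono fun φ hφ x => by
    refine ⟨shiftAt φ x, ?_, rfl⟩
    obtain ⟨b, hb⟩ := ((hφ x).image fun y => pairing h (shiftAt φ y).1).bddAbove
    obtain ⟨k, hk⟩ := exists_nat_ge b
    refine ⟨k, fun n => ?_⟩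
    rw [g.theta_shiftAt]
    exact (hb ⟨_, ⟨n, rfl⟩, rfl⟩).trans hk)
  rw [← hΦ.map_val_palmDistribution hB] at key
  filter_upwards [ae_of_ae_map measurable_subtype_coe.aemeasurable key] with φ hφ
  obtain ⟨ψ, hψ, hψφ⟩ := hφ
  rwa [Subtype.ext hψφ] at hψ

theorem isTightMeasureSet_gPalm (hpos : intensity ℙ Φ ≠ 0) (hfin : intensity ℙ Φ ≠ ∞)
    {g : PointMap d} (hg : HasFiniteOrbits g ℙ Φ) {B : Set (E d)} (hB : MeasurableSet B)
    (hB0 : volume B ≠ 0) (hB1 : volume B ≠ ∞) :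
    IsTightMeasureSet (Set.range (gPalm θ ℙ Φ B g)) := by
  have := hΦ.isProbabilityMeasure_palmDistribution hpos hfin hB hB0 hB1
  set P := palmDistribution θ ℙ Φ B
  refine isTightMeasureSet_iff_exists_isCompact_measure_compl_le.2 fun ε hε => ?_
  obtain ⟨ε', hε', hsum⟩ := ENNReal.exists_pos_sum_of_countable hε.ne' ℕ
  -- The quantifier over `n` is inside the event, so the levels chosen below do not depend on `n`.
  let S : ℕ → ℕ → Set (CountingMeasure₀ d) := fun r k =>
    {φ | ∃ n, (k : ℝ) < pairing (cutoff d r) (g.theta n φ).1}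
  have hS : ∀ r k, MeasurableSet (S r k) := fun r k => by
    simp only [S, Set.ofPred_exists]
    exact MeasurableSet.iUnion fun n =>
      ((measurable_pairing _).comp (measurable_subtype_coe.comp (g.measurable_theta n)))
        measurableSet_Ioi
  have hex : ∀ r, ∃ k, P (S r k) ≤ ε' r := by
    intro r
    have hlim := tendsto_measure_iInter_atTop (μ := P) (fun k => (hS r k).nullMeasurableSet)
      (fun j k hjk φ hφ => hφ.imp fun n hn => (Nat.cast_le.2 hjk).trans_lt hn)
      ⟨0, measure_ne_top _ _⟩
    have h0 : P (⋂ k, S r k) = 0 := by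
      refine measure_mono_null (fun φ hφ => ?_)
        (hΦ.ae_palmDistribution_exists_bound hg hB (cutoff d r))
      rintro ⟨k, hk⟩
      obtain ⟨n, hn⟩ := Set.mem_iInter.1 hφ k
      exact hn.not_ge (hk n)
    rw [h0] at hlim
    obtain ⟨k, hk⟩ := (hlim.eventually (gt_mem_nhds (ENNReal.coe_pos.2 (hε' r)))).exists
    exact ⟨k, hk.le⟩
  choose k hk using hex
  refine ⟨_, isCompact_setOf_pairing_cutoff_le fun r => (k r : ℝ), ?_⟩
  rintro _ ⟨n, rfl⟩
  have hK := (isCompact_setOf_pairing_cutoff_le (d := d) fun r => (k r : ℝ)).isClosed.measurableSet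
  rw [gPalm, Measure.map_apply (g.measurable_theta n) hK.compl]
  calc P _ ≤ P (⋃ r, S r (k r)) := measure_mono fun φ hφ => by
        obtain ⟨r, hr⟩ := not_forall.1 hφ
        exact Set.mem_iUnion.2 ⟨r, n, not_le.1 hr⟩
    _ ≤ ∑' r, P (S r (k r)) := measure_iUnion_le _
    _ ≤ ∑' r, (ε' r : ℝ≥0∞) := ENNReal.tsum_le_tsum hk
    _ ≤ ε := hsum.le

end IsStationaryPointProcess

end PointMapPalm

end

theorem mainTheorem11 {d : ℕ} {Ω : Type*} [MeasurableSpace Ω]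
    (θ : PointMapPalm.E d → Ω → Ω) (ℙ : Measure Ω) (Φ : Ω → PointMapPalm.CountingMeasure d)
    (hΦ : PointMapPalm.IsStationaryPointProcess θ ℙ Φ)
    (hpos : PointMapPalm.intensity ℙ Φ ≠ 0) (hfin : PointMapPalm.intensity ℙ Φ ≠ ∞)
    (g : PointMapPalm.PointMap d) (hg : PointMapPalm.HasFiniteOrbits g ℙ Φ)
    (B : Set (PointMapPalm.E d)) (hB : MeasurableSet B)
    (hB0 : volume B ≠ 0) (hB1 : volume B ≠ ∞) :
    ∃ Q : ℕ → ProbabilityMeasure (PointMapPalm.CountingMeasure₀ d),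
      (Q 0 : Measure (PointMapPalm.CountingMeasure₀ d))
        = PointMapPalm.palmDistribution θ ℙ Φ B ∧
      (∀ n, (Q n : Measure (PointMapPalm.CountingMeasure₀ d))
        = PointMapPalm.gPalm θ ℙ Φ B g n) ∧
      IsCompact (closure (Set.range Q)) ∧
      (PointMapPalm.omegaLimitSet Q).Nonempty := by
  have hP := hΦ.isProbabilityMeasure_palmDistribution hpos hfin hB hB0 hB1
  let Q : ℕ → ProbabilityMeasure (PointMapPalm.CountingMeasure₀ d) := fun n =>
    ⟨PointMapPalm.gPalm θ ℙ Φ B g n,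
      Measure.isProbabilityMeasure_map (g.measurable_theta n).aemeasurable⟩
  -- Prokhorov's theorem.
  have hcpt : IsCompact (closure (Set.range Q)) := by
    refine isCompact_closure_of_isTightMeasureSet
      ((hΦ.isTightMeasureSet_gPalm hpos hfin hg hB hB0 hB1).subset ?_)
    rintro _ ⟨_, ⟨n, rfl⟩, rfl⟩
    exact ⟨n, rfl⟩
  refine ⟨Q, ?_, fun n => rfl, hcpt, ?_⟩
  · change (PointMapPalm.palmDistribution θ ℙ Φ B).map (g.theta 0) = _
    rw [funext g.theta_zero]
    exact Measure.map_id
  · obtain ⟨y, -, n, hn, hy⟩ := hcpt.tendsto_subseq fun n => subset_closure (Set.mem_range_self n)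
    exact ⟨y, n, hn, hy⟩
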